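/- Let $|\cdot|$ be the Euclidean norm and let $\partial$ denote the (limiting) subdifferential of variational analysis, which for finite convex functions is the subdifferential of convex analysis. \textbf{Partial smoothness.} A finite function $h$ on $\mathbb{R}^m$ is \emph{partly smooth} at $\bar c$ relative to a set $\mathcal M\ni\bar c$ if: near $\bar c$, $\mathcal M=\{F=0\}$ for a map $F:\mathbb{R}^m\to\mathbb{R}^k$ that is $C^2$ around $\bar c$ with $\nabla F(\bar c)$ surjective; $h|_{\mathcal M}$ is $C^2$ near $\bar c$; $h$ is subdifferentially regular with $\partial h(z)\neq\emptyset$ at all $z\in\mathcal M$ near $\bar c$; the affine span of $\partial h(\bar c)$ is a translate of the normal space $N_{\mathcal M}(\bar c)=\mathrm{Range}(\nabla F(\bar c)^*)$; and the set-valued map $z\mapsto\partial h(z)$ restricted to $\mathcal M$ is continuous at $\bar c$ (outer and inner semicontinuous). \textbf{Algorithm ProxDescent.} For $x\in\mathbb{R}^n$ and $\mu>0$ put $h_{x,\mu}(d)=h\big(c(x)+\nabla c(x)d\big)+\frac{\mu}{2}|d|^2$. Fix $\tau>1$, $\sigma\in(0,1)$, $\mu_{\min}>0$, choose $x_0\in\mathbb{R}^n$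 and $\mu\ge\mu_{\min}$. In iteration $k=0,1,2,\dots$ repeat the following trial until it is accepted. Find a local minimizer $d_k$ of $h_{x_k,\mu}$ with $h_{x_k,\mu}(d_k)<h_{x_k,\mu}(0)$ (if there is none, terminate), and derive a point $x_k^+$ from $x_k+d_k$. If $$h(c(x_k))-h(c(x_k^+))\ \ge\ \sigma\big[h(c(x_k))-h(c(x_k)+\nabla c(x_k)d_k)\big]\quad\text{and}\quad |x_k^+-(x_k+d_k)|\le\tfrac12|d_k|,$$ accept: set $x_{k+1}=x_k^+$, $\mu_k=\mu$ and then replace $\mu$ by $\max(\mu_{\min},\mu/\tau)$; otherwise reject: replace $\mu$ by $\tau\mu$ and try again. The points $x_k^+$ are derived by \emph{efficient projection near} $\bar x$: there are constants $\gamma,\delta>0$ such that, for every trial (accepted or not) with $|x_k-\bar x|\le\delta$, $|d_k|\le\delta$ and $|h(c(x_k)+\nabla c(x_k)d_k)-h(c(\bar x))|<\delta$, either $$|x_k^+-(x_k+d_k)|\le\gamma|d_k|^2\quad\text{and}\quad h(c(x_k^+))\le h\big(c(x_k)+\nabla c(x_k)d_k\big)+\gamma|d_k|^2,$$ or $x_k^+$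 is some other point that passes the acceptance test. \textbf{Theorem.} Let $h:\mathbb{R}^m\to\mathbb{R}$ be convex, let $c:\mathbb{R}^n\to\mathbb{R}^m$ be $C^2$ near $\bar x\in\mathbb{R}^n$, let $\bar x$ be critical for $h\circ c$, that is, $0\in\partial(h\circ c)(\bar x)$, and put $\bar c=c(\bar x)$. Suppose that $h$ is partly smooth at $\bar c$ relative to $\mathcal M$, that $$\mathrm{par}\,\partial h(\bar c)\cap\mathrm{Null}(\nabla c(\bar x)^*)=\{0\},$$ where $\mathrm{par}$ denotes the subspace parallel to the affine span, and that $$\mathrm{ri}\,\partial h(\bar c)\cap\mathrm{Null}(\nabla c(\bar x)^*)\ne\emptyset .$$ If Algorithm ProxDescent, with points $x_k^+$ derived by efficient projection near $\bar x$, generates an infinite sequence $x_r\to\bar x$, with accepted steps $d_r$ and accepted parameters $\mu_r$, then $c(x_r)+\nabla c(x_r)d_r\in\mathcal M$ for all sufficiently large $r$, and the sequence $\{\mu_r\}$ is bounded. -/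

import Mathlib

open Filter Topology Set

namespace ProxLin

section Subgradients

variable {E : Type*} [NormedAddCommGroup E] [InnerProductSpace ℝ E]

/-- The regular (Fréchet) subdifferential of a finite function:
`f y ≥ f x + ⟨v, y - x⟩ + o(‖y - x‖)` as `y → x`. -/
def regularSubdiff (f : E → ℝ) (x : E) : Set E :=
  {v | ∀ ε > 0, ∀ᶠ y in 𝓝 x, f x + inner ℝ v (y - x) - ε * ‖y - x‖ ≤ f y}

/-- The (limiting) subdifferential `∂f(x)` of variational analysis, for a finite function:
limits of regular subgradients `u r` at points `y r → x` with `f (y r) → f x`. -/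
def subdiff (f : E → ℝ) (x : E) : Set E :=
  {v | ∃ (y u : ℕ → E), Tendsto y atTop (𝓝 x) ∧ Tendsto (fun r => f (y r)) atTop (𝓝 (f x)) ∧
    (∀ r, u r ∈ regularSubdiff f (y r)) ∧ Tendsto u atTop (𝓝 v)}

/-- `x` is critical for `f`: `0 ∈ ∂f(x)`. -/
def IsCritical (f : E → ℝ) (x : E) : Prop := (0 : E) ∈ subdiff f x

/-- Subdifferential regularity of a locally Lipschitz function at `x`: in every direction `d` the
classical one-sided directional derivative exists and equals the upper limit of `⟨∇h(y), d⟩` as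
`y → x` over the points `y` where `h` is differentiable. -/
def SubdiffRegularAt (h : E → ℝ) (x : E) : Prop :=
  (∃ K : NNReal, ∃ U ∈ 𝓝 x, LipschitzOnWith K h U) ∧
  ∀ d : E, ∃ l : ℝ,
    Tendsto (fun t : ℝ => (h (x + t • d) - h x) / t) (𝓝[>] 0) (𝓝 l) ∧
    limsup (fun y : E => ((fderiv ℝ h y d : ℝ) : EReal))
      (𝓝 x ⊓ 𝓟 {y | DifferentiableAt ℝ h y}) = (l : EReal)

/-- Continuity (in the sense of Painlevé and Kuratowski) at `x`, relative to the set `M`, of a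
set-valued map `S`: outer semicontinuity and inner semicontinuity. -/
def SetValuedContinuousWithinAt {X Y : Type*} [TopologicalSpace X] [TopologicalSpace Y]
    (S : X → Set Y) (M : Set X) (x : X) : Prop :=
  (∀ v, (∀ U ∈ 𝓝 v, ∃ᶠ y in 𝓝[M] x, (S y ∩ U).Nonempty) → v ∈ S x) ∧
  (∀ v ∈ S x, ∀ U ∈ 𝓝 v, ∀ᶠ y in 𝓝[M] x, (S y ∩ U).Nonempty)

variable [CompleteSpace E]

/-- `G` is a local system of `C²` equations with linearly independent gradients that describes
the set `M` near its point `x`. -/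
structure IsLocalEquation {k : ℕ} (G : E → EuclideanSpace ℝ (Fin k)) (M : Set E) (x : E) :
    Prop where
  mem : x ∈ M
  contDiffAt : ContDiffAt ℝ 2 G x
  surjective : Function.Surjective (fderiv ℝ G x)
  mem_iff : ∀ᶠ y in 𝓝 x, (y ∈ M ↔ G y = 0)

/-- The normal space at `x` to the manifold with local equation `G = 0`: the range of the adjoint
of the derivative of `G` at `x`. -/
noncomputable def normalSpace {k : ℕ} (G : E → EuclideanSpace ℝ (Fin k)) (x : E) :
    Submodule ℝ E :=
  LinearMap.range (ContinuousLinearMap.adjoint (fderiv ℝ G x)).toLinearMap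

/-- `h` is (`C²`-)partly smooth at `x` relative to `M`. -/
def PartlySmoothAt (h : E → ℝ) (M : Set E) (x : E) : Prop :=
  ∃ (k : ℕ) (G : E → EuclideanSpace ℝ (Fin k)),
    IsLocalEquation G M x ∧
    -- smoothness: the restriction of `h` to `M` is `C²` near `x`
    (∃ g : E → ℝ, ContDiffAt ℝ 2 g x ∧ ∀ᶠ y in 𝓝[M] x, h y = g y) ∧
    -- regularity
    (∀ᶠ y in 𝓝[M] x, SubdiffRegularAt h y ∧ (subdiff h y).Nonempty) ∧
    -- sharpness: the affine span of the subdifferential is a translate of the normal space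
    (∃ v : E, affineSpan ℝ (subdiff h x) = AffineSubspace.mk' v (normalSpace G x)) ∧
    -- sub-continuity
    SetValuedContinuousWithinAt (subdiff h) M x

end Subgradients

section Composite

variable {E F : Type*} [NormedAddCommGroup E] [InnerProductSpace ℝ E] [CompleteSpace E]
  [NormedAddCommGroup F] [InnerProductSpace ℝ F] [CompleteSpace F]

/-- `Null(∇c(x)^*)`. -/
noncomputable def nullAdjoint (c : E → F) (x : E) : Submodule ℝ F :=
  LinearMap.ker (ContinuousLinearMap.adjoint (fderiv ℝ c x)).toLinearMap

/-- The constraint qualification `par ∂h(c(x)) ∩ Null(∇c(x)^*) = {0}`, where `par` denotes the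
subspace parallel to the affine span. -/
def ConstraintQualification (h : F → ℝ) (c : E → F) (x : E) : Prop :=
  (affineSpan ℝ (subdiff h (c x))).direction ⊓ nullAdjoint c x = ⊥

/-- The strict criticality condition `ri ∂h(c(x)) ∩ Null(∇c(x)^*) ≠ ∅`. -/
def StrictlyCritical (h : F → ℝ) (c : E → F) (x : E) : Prop :=
  (intrinsicInterior ℝ (subdiff h (c x)) ∩ (nullAdjoint c x : Set F)).Nonempty

end Composite

section Algorithm

variable {E F : Type*} [NormedAddCommGroup E] [InnerProductSpace ℝ E]
  [NormedAddCommGroup F] [InnerProductSpace ℝ F]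

/-- The linearized prediction `c(x) + ∇c(x) d`. -/
noncomputable def linearization (c : E → F) (x d : E) : F := c x + fderiv ℝ c x d

/-- The proximal linearized objective
`h_{x,μ}(d) = h(c(x) + ∇c(x) d) + (μ/2) |d|²`. -/
noncomputable def proxObjective (h : F → ℝ) (c : E → F) (x : E) (μ : ℝ) (d : E) : ℝ :=
  h (linearization c x d) + μ / 2 * ‖d‖ ^ 2

/-- An admissible trial step: a local minimizer `d` of `h_{x,μ}` with `h_{x,μ}(d) < h_{x,μ}(0)`. -/
def IsTrialStep (h : F → ℝ) (c : E → F) (x : E) (μ : ℝ) (d : E) : Prop :=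
  IsLocalMin (proxObjective h c x μ) d ∧ proxObjective h c x μ d < proxObjective h c x μ 0

/-- The acceptance test for the trial point `xp` derived from `x + d`. -/
def Accepts (h : F → ℝ) (c : E → F) (σ : ℝ) (x d xp : E) : Prop :=
  σ * (h (c x) - h (linearization c x d)) ≤ h (c x) - h (c xp) ∧
  ‖xp - (x + d)‖ ≤ 1 / 2 * ‖d‖

/-- `xp` is an efficient projection of `x + d`, with constant `γ`. -/
def IsEfficientProjection (h : F → ℝ) (c : E → F) (γ : ℝ) (x d xp : E) : Prop :=
  ‖xp - (x + d)‖ ≤ γ * ‖d‖ ^ 2 ∧ h (c xp) ≤ h (linearization c x d) + γ * ‖d‖ ^ 2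

/-- A run of Algorithm ProxDescent that does not terminate. In outer iteration `k`, at the iterate
`x k`, the inner loop starts with the proximality parameter `ν k` and makes the trials
`j = 0, …, J k`; trial `j` uses the parameter `τ ^ j * ν k`, the step `d k j` and the trial point
`xp k j`. The trials `j < J k` are rejected and trial `J k` is accepted. -/
structure ProxDescentRun (h : F → ℝ) (c : E → F) where
  τ : ℝ
  σ : ℝ
  μmin : ℝ
  one_lt_τ : 1 < τ
  σ_pos : 0 < σ
  σ_lt_one : σ < 1
  μmin_pos : 0 < μmin
  x : ℕ → E
  ν : ℕ → ℝ
  J : ℕ → ℕ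
  d : ℕ → ℕ → E
  xp : ℕ → ℕ → E
  ν_zero : μmin ≤ ν 0
  trial : ∀ k, ∀ j ≤ J k, IsTrialStep h c (x k) (τ ^ j * ν k) (d k j)
  rejected : ∀ k, ∀ j < J k, ¬ Accepts h c σ (x k) (d k j) (xp k j)
  accepted : ∀ k, Accepts h c σ (x k) (d k (J k)) (xp k (J k))
  x_succ : ∀ k, x (k + 1) = xp k (J k)
  ν_succ : ∀ k, ν (k + 1) = max μmin (τ ^ J k * ν k / τ)

namespace ProxDescentRun

variable {h : F → ℝ} {c : E → F}

/-- The accepted proximality parameter `μ_k`. -/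
noncomputable def μ (R : ProxDescentRun h c) (k : ℕ) : ℝ := R.τ ^ R.J k * R.ν k

/-- The accepted step `d_k`. -/
def step (R : ProxDescentRun h c) (k : ℕ) : E := R.d k (R.J k)

/-- The run uses the efficient projection technique near `xbar`: for some constants `γ, δ > 0`,
each trial point is an efficient projection with constant `γ`, or has been enhanced to some other
point that passes the acceptance test, whenever the iterate is within `δ` of `xbar`, the step has
length at most `δ` and the predicted value is within `δ` of `h(c(xbar))`. -/
def UsesEfficientProjectionNear (R : ProxDescentRun h c) (xbar : E) : Prop :=
  ∃ γ > 0, ∃ δ > 0, ∀ k, ∀ j ≤ R.J k,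
    ‖R.x k - xbar‖ ≤ δ → ‖R.d k j‖ ≤ δ →
    |h (linearization c (R.x k) (R.d k j)) - h (c xbar)| < δ →
      IsEfficientProjection h c γ (R.x k) (R.d k j) (R.xp k j) ∨
      Accepts h c R.σ (R.x k) (R.d k j) (R.xp k j)

end ProxDescentRun

end Algorithm

end ProxLin

/-! A subgradient of `h` at `c xbar` bounds the linearized model below by an affine function, so for
large `μ` every trial step near `xbar` is short and efficient projection applies. Its error `γ|d|²`
is then beaten by the predicted decrease, which is at least `(μ/2)|d|²`. Hence trials with `μ` above
a fixed threshold are accepted, and `μ` cannot blow up (`bddAbove_range_μ`).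

The half-step test forces the accepted steps to zero. With `μ` bounded, optimality gives
subgradients `v r` at the predicted points with `∇c(x r)^* (v r) = -μ r d r → 0`. Local boundedness
and the constraint qualification then give `v r → w`, the multiplier in the relative interior
(`tendsto_multiplier`).

Identification (`PartlySmoothAt.eventually_mem`): if points `z` off `M` persisted, their unit normal
displacements from `M` would have a limit `n`. Sharpness puts `w + ε n` in the subdifferential,
inner semicontinuity approximates it at the projections of the `z`, and this contradicts
monotonicity. -/

namespace ProxLin

/-! ### Convex subgradients: global inequality, monotonicity, closed graph, local boundedness. -/

section ConvexSubgradients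

variable {E : Type*} [NormedAddCommGroup E] [InnerProductSpace ℝ E]

/-- A regular subgradient of a convex function is a subgradient in the sense of convex analysis. -/
theorem le_of_mem_regularSubdiff {f : E → ℝ} (hf : ConvexOn ℝ univ f) {x v : E}
    (hv : v ∈ regularSubdiff f x) (y : E) : f x + inner ℝ v (y - x) ≤ f y := by
  refine le_of_forall_pos_le_add fun ε hε => ?_
  -- The local inequality at `x + t(y - x)` becomes global through convexity on the segment and
  -- division by `t`. The `+ 1` covers `y = x`.
  have hpos : 0 < ‖y - x‖ + 1 := by positivity
  have hline : Tendsto (fun t : ℝ => x + t • (y - x)) (𝓝[>] 0) (𝓝 x) := by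
    have : Continuous fun t : ℝ => x + t • (y - x) := by fun_prop
    simpa using (this.tendsto 0).mono_left nhdsWithin_le_nhds
  obtain ⟨t, ht, ht0, ht1⟩ := ((hline.eventually (hv (ε / (‖y - x‖ + 1)) (by positivity))).and
    (Ioo_mem_nhdsGT (zero_lt_one (α := ℝ)))).exists
  have hc := hf.2 (mem_univ x) (mem_univ y) (sub_nonneg.2 ht1.le) ht0.le (by ring)
  rw [show (1 - t) • x + t • y = x + t • (y - x) by module] at hc
  simp only [smul_eq_mul, add_sub_cancel_left, inner_smul_right, norm_smul, Real.norm_eq_abs,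
    abs_of_pos ht0] at hc ht
  have hε' : ε / (‖y - x‖ + 1) * ‖y - x‖ ≤ ε := by
    rw [div_mul_eq_mul_div, div_le_iff₀ hpos]
    nlinarith
  have : t * (f x + inner ℝ v (y - x)) ≤ t * (f y + ε) := by nlinarith
  exact le_of_mul_le_mul_left this ht0

theorem mem_regularSubdiff_of_forall_le {f : E → ℝ} {x v : E}
    (hv : ∀ y, f x + inner ℝ v (y - x) ≤ f y) : v ∈ regularSubdiff f x := fun ε hε =>
  .of_forall fun y => (sub_le_self _ (by positivity)).trans (hv y)

/-- The limiting subdifferential of a continuous convex function is the subdifferential of convex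
analysis. -/
theorem mem_subdiff_iff {f : E → ℝ} (hf : ConvexOn ℝ univ f) {x v : E} :
    v ∈ subdiff f x ↔ ∀ y, f x + inner ℝ v (y - x) ≤ f y := by
  refine ⟨?_, fun hv => ⟨fun _ => x, fun _ => v, tendsto_const_nhds, tendsto_const_nhds,
    fun _ => mem_regularSubdiff_of_forall_le hv, tendsto_const_nhds⟩⟩
  rintro ⟨p, u, hp, hfp, hu, huv⟩ y
  exact le_of_tendsto (hfp.add (huv.inner (tendsto_const_nhds.sub hp)))
    (.of_forall fun r => le_of_mem_regularSubdiff hf (hu r) y)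

/-- Monotonicity of the subdifferential of a convex function. -/
theorem inner_sub_nonneg_of_mem_subdiff {f : E → ℝ} (hf : ConvexOn ℝ univ f) {x y v w : E}
    (hv : v ∈ subdiff f x) (hw : w ∈ subdiff f y) : 0 ≤ inner ℝ (v - w) (x - y) := by
  have h1 := (mem_subdiff_iff hf).1 hv y
  have h2 := (mem_subdiff_iff hf).1 hw x
  rw [← neg_sub x y, inner_neg_right] at h1
  rw [inner_sub_left]
  linarith

/-- Closedness of the graph of the subdifferential of a continuous convex function. -/
theorem mem_subdiff_of_tendsto {ι : Type*} {l : Filter ι} [l.NeBot] {f : E → ℝ}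
    (hf : ConvexOn ℝ univ f) (hcont : Continuous f) {x v : E} {p u : ι → E}
    (hp : Tendsto p l (𝓝 x)) (hu : Tendsto u l (𝓝 v)) (hmem : ∀ i, u i ∈ subdiff f (p i)) :
    v ∈ subdiff f x :=
  (mem_subdiff_iff hf).2 fun y => le_of_tendsto
    (((hcont.tendsto x).comp hp).add (hu.inner (tendsto_const_nhds.sub hp)))
    (.of_forall fun i => (mem_subdiff_iff hf).1 (hmem i) y)

/-- Local boundedness of the subdifferential of a continuous convex function. -/
theorem eventually_subdiff_subset_closedBall {f : E → ℝ} (hf : ConvexOn ℝ univ f)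
    (hcont : Continuous f) (x : E) :
    ∃ L : ℝ, ∀ᶠ z in 𝓝 x, subdiff f z ⊆ Metric.closedBall 0 L := by
  obtain ⟨ρ, hρ, hball⟩ := Metric.continuousAt_iff.1 hcont.continuousAt 1 one_pos
  -- A step of length `ρ/2` from `z` along `v` raises `f` by at least `(ρ/2)‖v‖`, but `f` varies by
  -- less than `2` on the `ρ`-ball.
  refine ⟨4 / ρ, ?_⟩
  filter_upwards [Metric.ball_mem_nhds x (half_pos hρ)] with z hz v hv
  rw [mem_closedBall_zero_iff]
  rcases eq_or_ne v 0 with rfl | hv0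
  · rw [norm_zero]; positivity
  have hvpos : 0 < ‖v‖ := norm_pos_iff.2 hv0
  have hsub := (mem_subdiff_iff hf).1 hv (z + (ρ / 2 / ‖v‖) • v)
  have hz1 : |f z - f x| < 1 := hball ((Metric.mem_ball.1 hz).trans (by linarith))
  have hnorm : ‖(ρ / 2 / ‖v‖) • v‖ = ρ / 2 := by
    rw [norm_smul, Real.norm_of_nonneg (by positivity)]
    field_simp
  have hz2 : |f (z + (ρ / 2 / ‖v‖) • v) - f x| < 1 := by
    refine hball ?_
    calc dist (z + (ρ / 2 / ‖v‖) • v) x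
        ≤ dist (z + (ρ / 2 / ‖v‖) • v) z + dist z x := dist_triangle _ _ _
      _ < ρ / 2 + ρ / 2 := by
          rw [dist_self_add_left, hnorm]
          exact add_lt_add_right (Metric.mem_ball.1 hz) _
      _ = ρ := by ring
  rw [add_sub_cancel_left, inner_smul_right, real_inner_self_eq_norm_sq,
    show ρ / 2 / ‖v‖ * ‖v‖ ^ 2 = ρ / 2 * ‖v‖ by field_simp] at hsub
  rw [abs_lt] at hz1 hz2
  rw [le_div_iff₀ hρ]
  linarith

end ConvexSubgradients

/-! ### Chain rule and optimality condition by Hahn–Banach separation. -/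

section ChainRule

variable {E F : Type*} [NormedAddCommGroup E] [InnerProductSpace ℝ E] [CompleteSpace E]
  [NormedAddCommGroup F] [InnerProductSpace ℝ F] [CompleteSpace F]

/-- Chain rule: a subgradient at `d` of the composition of a continuous convex function with an
affine map is the image of a subgradient under the adjoint of the linear part. -/
theorem exists_mem_subdiff_adjoint_eq {h : F → ℝ} (hh : ConvexOn ℝ univ h) (hcont : Continuous h)
    (A : E →L[ℝ] F) (b : F) {d p : E}
    (hp : ∀ e, h (b + A d) + inner ℝ p (e - d) ≤ h (b + A e)) :
    ∃ v ∈ subdiff h (b + A d), ContinuousLinearMap.adjoint A v = p := by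
  -- The strict epigraph, open by continuity, is separated from the affine minorant carried over the
  -- range of `e ↦ b + A e`.
  have hs₁ : Convex ℝ {q : F × ℝ | h q.1 < q.2} := by simpa using hh.convex_strict_epigraph
  have hs₂ : IsOpen {q : F × ℝ | h q.1 < q.2} :=
    isOpen_lt (hcont.comp continuous_fst) continuous_snd
  have ht : Convex ℝ (range fun e : E => (b + A e, h (b + A d) + inner ℝ p (e - d))) := by
    rintro _ ⟨e₁, rfl⟩ _ ⟨e₂, rfl⟩ s t hs ht hst
    refine ⟨s • e₁ + t • e₂, ?_⟩
    obtain rfl : t = 1 - s := by linarith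
    ext1
    · simp only [map_add, map_smul, Prod.fst_add, Prod.smul_fst]
      module
    · simp only [inner_sub_right, inner_add_right, inner_smul_right, Prod.snd_add, Prod.smul_snd,
        smul_eq_mul]
      ring
  obtain ⟨f, u, hfs, hft⟩ := geometric_hahn_banach_open hs₁ hs₂ ht (by
    rw [disjoint_left]
    rintro _ hq ⟨e, rfl⟩
    exact absurd (hp e) (not_le.2 hq))
  set β := f (0, 1) with hβ
  have hf : ∀ y s, f (y, s) = f (y, 0) + s * β := fun y s => by
    rw [hβ, ← smul_eq_mul, ← map_smul, ← map_add]
    simp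
  have hsep : ∀ y s e, h y < s →
      f (y, 0) + s * β < f (b + A e, 0) + (h (b + A d) + inner ℝ p (e - d)) * β :=
    fun y s e hys => by
      rw [← hf, ← hf]
      exact (hfs (y, s) hys).trans_le (hft _ ⟨e, rfl⟩)
  -- The separating functional is not vertical-free: the two sets contain points over the same base
  -- point `b + A d`.
  have hβneg : β < 0 := by
    have := hsep (b + A d) (h (b + A d) + 1) d (by linarith)
    simp only [sub_self, inner_zero_right] at this
    linarith
  let v : F := (InnerProductSpace.toDual ℝ F).symm
    ((-β)⁻¹ • f.comp (ContinuousLinearMap.inl ℝ F ℝ))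
  have hv : ∀ y, f (y, 0) = -β * inner ℝ v y := fun y => by
    simp only [v, InnerProductSpace.toDual_symm_apply]
    simp [hβneg.ne]
  have hkey : ∀ y e, inner ℝ v y - h y ≤
      inner ℝ v (b + A e) - (h (b + A d) + inner ℝ p (e - d)) := fun y e => by
    refine le_of_forall_pos_le_add fun ε hε => ?_
    have := hsep y (h y + ε) e (by linarith)
    rw [hv, hv] at this
    have h2 : -β * (inner ℝ v y - h y) ≤ -β *
        (inner ℝ v (b + A e) - (h (b + A d) + inner ℝ p (e - d)) + ε) := by linarith
    exact le_of_mul_le_mul_left h2 (neg_pos.2 hβneg)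
  refine ⟨v, (mem_subdiff_iff hh).2 fun y => ?_, ?_⟩
  · have := hkey y d
    rw [sub_self, inner_zero_right] at this
    rw [inner_sub_right]
    linarith
  -- `e ↦ ⟨A^* v - p, e - d⟩` is nonnegative; moving against its gradient makes the gradient zero.
  · have h1 := hkey (b + A d) (d - (ContinuousLinearMap.adjoint A v - p))
    rw [map_sub, ← add_sub_assoc, inner_sub_right, sub_sub_cancel_left, inner_neg_right,
      ← ContinuousLinearMap.adjoint_inner_left] at h1
    have h2 : inner ℝ (ContinuousLinearMap.adjoint A v - p)
        (ContinuousLinearMap.adjoint A v - p) ≤ 0 := by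
      rw [inner_sub_left]
      linarith
    exact sub_eq_zero.1 (real_inner_self_nonpos.1 h2)

/-- First-order optimality condition for the proximal linearized subproblem. -/
theorem exists_mem_subdiff_of_isLocalMin_proxObjective {h : F → ℝ} (hh : ConvexOn ℝ univ h)
    (hcont : Continuous h) {c : E → F} {x d : E} {μ : ℝ}
    (hmin : IsLocalMin (proxObjective h c x μ) d) :
    ∃ v ∈ subdiff h (linearization c x d),
      ContinuousLinearMap.adjoint (fderiv ℝ c x) v = -(μ • d) := by
  refine exists_mem_subdiff_adjoint_eq hh hcont (fderiv ℝ c x) (c x) fun e => ?_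
  have hconv : ConvexOn ℝ univ fun e => h (c x + fderiv ℝ c x e) := by
    have := (hh.translate_right (c x)).comp_linearMap (fderiv ℝ c x).toLinearMap
    rwa [preimage_univ, preimage_univ] at this
  -- Expanded at `d`, the quadratic has linear part `μ⟨d, y - d⟩` and an `o(‖y - d‖)` remainder, so
  -- local minimality makes `-μ d` a regular subgradient, hence a global one.
  refine le_of_mem_regularSubdiff hconv (fun ε hε => ?_) e
  have hsmall : ∀ᶠ y in 𝓝 d, μ / 2 * ‖y - d‖ < ε := by
    have : Tendsto (fun y => μ / 2 * ‖y - d‖) (𝓝 d) (𝓝 (μ / 2 * ‖d - d‖)) := by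
      apply Continuous.tendsto; fun_prop
    rw [sub_self, norm_zero, mul_zero] at this
    exact this.eventually_lt_const hε
  filter_upwards [hmin, hsmall] with y hy hys
  have hexp : ‖y‖ ^ 2 = ‖d‖ ^ 2 + 2 * inner ℝ d (y - d) + ‖y - d‖ ^ 2 := by
    rw [← norm_add_sq_real, add_sub_cancel]
  simp only [proxObjective, linearization, hexp] at hy
  rw [inner_neg_left, real_inner_smul_left]
  nlinarith [mul_le_mul_of_nonneg_right hys.le (norm_nonneg (y - d))]

end ChainRule

/-! ### Identification of the active manifold. -/

section Identification

variable {E : Type*} [NormedAddCommGroup E] [InnerProductSpace ℝ E]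

/-- A point of the relative interior can be moved, inside the set, in every direction of the affine
span. -/
theorem exists_pos_add_smul_mem_of_mem_intrinsicInterior {S : Set E} {v w : E}
    (hv : v ∈ intrinsicInterior ℝ S) (hw : w ∈ (affineSpan ℝ S).direction) :
    ∃ ε > (0 : ℝ), v + ε • w ∈ S := by
  obtain ⟨y, hy, rfl⟩ := mem_intrinsicInterior.1 hv
  let γ : ℝ → affineSpan ℝ S := fun t =>
    ⟨(y : E) + t • w, by
      rw [add_comm]
      exact AffineSubspace.vadd_mem_of_mem_direction (Submodule.smul_mem _ t hw) y.2⟩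
  have hγ : Continuous γ := by
    apply Continuous.subtype_mk
    fun_prop
  have hγ0 : γ 0 = y := by simp [γ]
  have hev : ∀ᶠ t in 𝓝 (0 : ℝ), γ t ∈ interior ((↑) ⁻¹' S : Set (affineSpan ℝ S)) :=
    hγ.continuousAt.eventually (by rw [hγ0]; exact isOpen_interior.mem_nhds hy)
  obtain ⟨ε, hε, hε0⟩ := ((hev.filter_mono nhdsWithin_le_nhds).and
    (self_mem_nhdsWithin : Ioi (0 : ℝ) ∈ 𝓝[>] 0)).exists
  exact ⟨ε, hε0, interior_subset (s := ((↑) ⁻¹' S : Set (affineSpan ℝ S))) hε⟩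

variable [FiniteDimensional ℝ E]

/-- Projection onto a manifold along its normal space at a given point. -/
theorem IsLocalEquation.exists_projection {k : ℕ} {G : E → EuclideanSpace ℝ (Fin k)} {M : Set E}
    {x : E} (hG : IsLocalEquation G M x) :
    ∃ P : E → E, Tendsto P (𝓝 x) (𝓝[M] x) ∧ ∀ᶠ z in 𝓝 x, z - P z ∈ normalSpace G x := by
  let K : Submodule ℝ E := (fderiv ℝ G x).ker
  have hN : normalSpace G x = Kᗮ := by
    rw [(fderiv ℝ G x).orthogonal_ker]
    exact (Submodule.closed_of_finiteDimensional _).submodule_topologicalClosure_eq.symm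
  let φ : ImplicitFunctionData ℝ E (EuclideanSpace ℝ (Fin k)) K :=
    { leftFun := G
      leftDeriv := fderiv ℝ G x
      rightFun := K.orthogonalProjectionOnto
      rightDeriv := K.orthogonalProjectionOnto
      pt := x
      hasStrictFDerivAt_leftFun := hG.contDiffAt.hasStrictFDerivAt (by norm_num)
      hasStrictFDerivAt_rightFun := K.orthogonalProjectionOnto.hasStrictFDerivAt
      range_leftDeriv := LinearMap.range_eq_top.2 hG.surjective
      range_rightDeriv := LinearMap.range_eq_top.2 fun y =>
        ⟨y, K.orthogonalProjectionOnto_mem_subspace_eq_self y⟩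
      isCompl_ker := by
        rw [K.ker_orthogonalProjectionOnto]
        exact K.isCompl_orthogonal }
  -- `P z` is the solution of `G = 0` near `x` with the same `K`-component as `z`, so `z - P z` lies
  -- in `Kᗮ`, the normal space.
  let P : E → E := fun z => φ.implicitFunction (φ.leftFun φ.pt) (φ.rightFun z)
  have hP : Tendsto P (𝓝 x) (𝓝 x) := by
    have h1 : ContinuousAt (φ.implicitFunction (φ.leftFun φ.pt)) (φ.rightFun x) :=
      φ.differentiableAt_implicitFunction.continuousAt
    have h2 : ContinuousAt P x :=
      ContinuousAt.comp h1 (K.orthogonalProjectionOnto.continuous.continuousAt (x := x))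
    have h3 : P x = x := φ.implicitFunction_apply_image.self_of_nhds
    simpa only [ContinuousAt, h3] using h2
  have hGx : G x = 0 := hG.mem_iff.self_of_nhds.1 hG.mem
  refine ⟨P, tendsto_nhdsWithin_iff.2 ⟨hP, ?_⟩, ?_⟩
  · filter_upwards [hP.eventually hG.mem_iff, φ.leftFun_implicitFunction_eq_leftFun] with z h1 h2
    exact h1.2 (h2.trans hGx)
  · filter_upwards [φ.rightFun_implicitFunction_eq_rightFun] with z hz
    rw [hN, ← K.ker_orthogonalProjectionOnto, LinearMap.mem_ker]
    change K.orthogonalProjectionOnto (z - P z) = 0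
    rw [map_sub, sub_eq_zero]
    exact hz.symm

/-- Finite identification of the active manifold of a convex partly smooth function. -/
theorem PartlySmoothAt.eventually_mem {h : E → ℝ} (hh : ConvexOn ℝ univ h) {M : Set E} {x : E}
    (hps : PartlySmoothAt h M x) {ι : Type*} {l : Filter ι} {z v : ι → E} {w : E}
    (hz : Tendsto z l (𝓝 x)) (hv : Tendsto v l (𝓝 w)) (hmem : ∀ i, v i ∈ subdiff h (z i))
    (hw : w ∈ intrinsicInterior ℝ (subdiff h x)) : ∀ᶠ i in l, z i ∈ M := by
  obtain ⟨k, G, hG, -, -, ⟨a, ha⟩, -, hinner⟩ := hps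
  obtain ⟨P, hP, hPN⟩ := hG.exists_projection
  by_contra hnot
  have hne : (l ⊓ 𝓟 {i | z i ∉ M}).NeBot := by
    exact frequently_mem_iff_neBot.1 (not_eventually.1 hnot)
  -- An ultrafilter on the bad indices replaces passing to a subsequence.
  let U : Ultrafilter ι := .of (l ⊓ 𝓟 {i | z i ∉ M})
  have hU : (U : Filter ι) ≤ l ⊓ 𝓟 {i | z i ∉ M} := Ultrafilter.of_le _
  have hUl : (U : Filter ι) ≤ l := hU.trans inf_le_left
  have hzM : ∀ᶠ i in (U : Filter ι), z i ∉ M := hU.trans inf_le_right (mem_principal_self _)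
  have hzU := hz.mono_left hUl
  have hvU := hv.mono_left hUl
  have hPz : Tendsto (fun i => P (z i)) U (𝓝[M] x) := hP.comp hzU
  let e : ι → E := fun i => ‖z i - P (z i)‖⁻¹ • (z i - P (z i))
  have he : ∀ᶠ i in (U : Filter ι), e i ∈ Metric.sphere (0 : E) 1 ∩ normalSpace G x := by
    filter_upwards [hzM, hPz self_mem_nhdsWithin, hzU.eventually hPN] with i h1 h2 h3
    have hne : z i - P (z i) ≠ 0 := fun h0 => h1 (by rw [sub_eq_zero.1 h0]; exact h2)
    exact ⟨by simp [e, norm_smul, norm_ne_zero_iff.2 hne], Submodule.smul_mem _ _ h3⟩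
  have hcpt : IsCompact (Metric.sphere (0 : E) 1 ∩ normalSpace G x) :=
    (isCompact_sphere 0 1).inter_right (Submodule.closed_of_finiteDimensional _)
  obtain ⟨n, ⟨hn1, hnN⟩, hn⟩ := hcpt.ultrafilter_le_nhds (U.map e)
    (by rw [le_principal_iff]; exact he)
  have hen : Tendsto e U (𝓝 n) := hn
  -- Sharpness makes the normal direction `n` a direction of the affine span.
  obtain ⟨ε, hε, hεmem⟩ := exists_pos_add_smul_mem_of_mem_intrinsicInterior hw
    (w := n) (by rw [ha, AffineSubspace.direction_mk']; exact hnN)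
  have hsub := hPz.eventually (hinner _ hεmem (Metric.ball (w + ε • n) (ε / 2))
    (Metric.ball_mem_nhds _ (half_pos hε)))
  have hlim : Tendsto (fun i => inner ℝ (v i - (w + ε • n)) (e i)) U
      (𝓝 (inner ℝ (w - (w + ε • n)) n)) := (hvU.sub tendsto_const_nhds).inner hen
  have hval : inner ℝ (w - (w + ε • n)) n = -ε := by
    rw [sub_add_cancel_left, inner_neg_left, real_inner_smul_left, real_inner_self_eq_norm_sq,
      mem_sphere_zero_iff_norm.1 hn1]
    ring
  rw [hval] at hlim
  obtain ⟨i, hi1, ⟨u, hu, hub⟩, hi3⟩ := ((hlim.eventually_lt_const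
    (show -ε < -(ε / 2) by linarith)).and (hsub.and he)).exists
  -- Monotonicity between `z i` and `P (z i)`. The same product is below `-ε/2 + ε/2`: the first
  -- term bounds the part with limit `-ε`, the second the error of `u`.
  have hmono : 0 ≤ inner ℝ (v i - u) (e i) := by
    rw [inner_smul_right]
    exact mul_nonneg (by positivity) (inner_sub_nonneg_of_mem_subdiff hh (hmem i) hu)
  have hcs : inner ℝ (w + ε • n - u) (e i) ≤ ε / 2 := by
    refine (real_inner_le_norm _ _).trans ?_
    rw [mem_sphere_zero_iff_norm.1 hi3.1, mul_one, ← dist_eq_norm, dist_comm]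
    exact (Metric.mem_ball.1 hub).le
  rw [show v i - u = (v i - (w + ε • n)) + (w + ε • n - u) by abel, inner_add_left] at hmono
  linarith

end Identification

/-! ### Step lengths, acceptance, and boundedness of the proximality parameters. -/

section Descent

variable {E F : Type*} [NormedAddCommGroup E] [InnerProductSpace ℝ E]
  [NormedAddCommGroup F] [InnerProductSpace ℝ F]

/-- Joint continuity of evaluation. It supplies the predicted-value condition for efficient
projection and the convergence of predicted points needed for identification. -/
theorem tendsto_linearization {c : E → F} {xbar : E} (hc : ContinuousAt c xbar)
    (hc' : ContinuousAt (fderiv ℝ c) xbar) :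
    Tendsto (fun q : E × E => linearization c q.1 q.2) (𝓝 xbar ×ˢ 𝓝 0) (𝓝 (c xbar)) := by
  have := (hc.tendsto.comp tendsto_fst).add
    ((isBoundedBilinearMap_apply (𝕜 := ℝ)).continuous.tendsto (fderiv ℝ c xbar, 0) |>.comp
      ((hc'.tendsto.comp (tendsto_fst (g := 𝓝 (0 : E)))).prodMk_nhds tendsto_snd))
  simpa [linearization] using this

/-- The strict decrease of the proximal objective bounds the predicted decrease below; this is what
absorbs the projection error `γ|d|²`. -/
theorem IsTrialStep.le_sub {h : F → ℝ} {c : E → F} {x d : E} {μ : ℝ}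
    (hd : IsTrialStep h c x μ d) : μ / 2 * ‖d‖ ^ 2 ≤ h (c x) - h (linearization c x d) := by
  have := hd.2
  simp only [proxObjective, linearization, map_zero, add_zero, norm_zero] at this
  simp only [linearization]
  linarith

/-- Trial steps are short if the proximality parameter is large. -/
theorem exists_forall_trialStep_norm_le {h : F → ℝ} (hh : ConvexOn ℝ univ h)
    (hcont : Continuous h) {c : E → F} {xbar : E} (hc : ContinuousAt c xbar)
    (hc' : ContinuousAt (fderiv ℝ c) xbar) {v : F} (hv : v ∈ subdiff h (c xbar))
    {s : ℝ} (hs : 0 < s) :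
    ∃ C : ℝ, ∀ᶠ x in 𝓝 xbar, ∀ μ ≥ C, ∀ d, IsTrialStep h c x μ d → ‖d‖ ≤ s := by
  set K : ℝ := ‖v‖ * (‖fderiv ℝ c xbar‖ + 1) with hK
  have hK0 : 0 ≤ K := by positivity
  -- Descent forces `(μ/2)‖d‖² < 1 + K‖d‖`. This constant reverses the inequality when `‖d‖ > s`,
  -- using `1 ≤ ‖d‖/s` twice.
  refine ⟨2 / s * (1 / s + K), ?_⟩
  have h1 : ∀ᶠ x in 𝓝 xbar, h (c x) - h (c xbar) - inner ℝ v (c x - c xbar) < 1 := by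
    have : Tendsto (fun x => h (c x) - h (c xbar) - inner ℝ v (c x - c xbar)) (𝓝 xbar)
        (𝓝 (h (c xbar) - h (c xbar) - inner ℝ v (c xbar - c xbar))) :=
      (((hcont.tendsto _).comp hc.tendsto).sub_const _).sub
        (tendsto_const_nhds.inner (hc.tendsto.sub_const _))
    rw [sub_self, sub_self, inner_zero_right, sub_zero] at this
    exact this.eventually_lt_const one_pos
  have h2 : ∀ᶠ x in 𝓝 xbar, ‖fderiv ℝ c x‖ < ‖fderiv ℝ c xbar‖ + 1 :=
    hc'.norm.eventually_lt_const (lt_add_one _)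
  filter_upwards [h1, h2] with x hx1 hx2 μ hμ d hd
  by_contra! hlt
  have hd1 := hd.2
  have hd2 := (mem_subdiff_iff hh).1 hv (linearization c x d)
  simp only [proxObjective, linearization, map_zero, add_zero, norm_zero] at hd1 hd2
  rw [add_sub_right_comm, inner_add_right] at hd2
  have hd3 : -(K * ‖d‖) ≤ inner ℝ v (fderiv ℝ c x d) := by
    refine (abs_le.1 ((abs_real_inner_le_norm v (fderiv ℝ c x d)).trans ?_)).1
    rw [hK, mul_assoc]
    gcongr
    exact ((fderiv ℝ c x).le_opNorm d).trans (by gcongr)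
  have hd4 : 1 + K * ‖d‖ ≤ μ / 2 * ‖d‖ ^ 2 := by
    have hone : 1 ≤ ‖d‖ / s := (one_le_div hs).2 hlt.le
    calc 1 + K * ‖d‖ ≤ ‖d‖ / s + K * ‖d‖ := by gcongr
      _ = 1 * ((1 / s + K) * ‖d‖) := by ring
      _ ≤ ‖d‖ / s * ((1 / s + K) * ‖d‖) := by gcongr
      _ = (2 / s * (1 / s + K)) / 2 * ‖d‖ ^ 2 := by ring
      _ ≤ μ / 2 * ‖d‖ ^ 2 := by gcongr
  linarith

/-- Efficient projections of short steps pass the acceptance test if the proximality parameter is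
large. -/
theorem IsEfficientProjection.accepts {h : F → ℝ} {c : E → F} {γ σ μ : ℝ} {x d xp : E}
    (hxp : IsEfficientProjection h c γ x d xp) (hd : IsTrialStep h c x μ d) (hσ : σ < 1)
    (hμ : 2 * γ / (1 - σ) ≤ μ) (hγd : γ * ‖d‖ ≤ 1 / 2) : Accepts h c σ x d xp := by
  have hσ' : 0 < 1 - σ := sub_pos.2 hσ
  refine ⟨?_, hxp.1.trans ?_⟩
  -- The test leaves a slack of `1 - σ` times the predicted decrease; the threshold `2γ/(1 - σ)`
  -- fits the error into it.
  · have h1 : γ * ‖d‖ ^ 2 ≤ (1 - σ) * (h (c x) - h (linearization c x d)) :=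
      calc γ * ‖d‖ ^ 2 = (1 - σ) * ((2 * γ / (1 - σ)) / 2 * ‖d‖ ^ 2) := by field_simp
        _ ≤ (1 - σ) * (μ / 2 * ‖d‖ ^ 2) := by gcongr
        _ ≤ _ := by gcongr; exact hd.le_sub
    linarith [hxp.2]
  · rw [sq, ← mul_assoc]
    gcongr

namespace ProxDescentRun

variable {h : F → ℝ} {c : E → F} (R : ProxDescentRun h c)

theorem μmin_le_ν (k : ℕ) : R.μmin ≤ R.ν k := by
  cases k with
  | zero => exact R.ν_zero
  | succ k => rw [R.ν_succ]; exact le_max_left _ _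

theorem μ_pos (k : ℕ) : 0 < R.μ k :=
  mul_pos (pow_pos (zero_lt_one.trans R.one_lt_τ) _) (R.μmin_pos.trans_le (R.μmin_le_ν k))

theorem isTrialStep (k : ℕ) : IsTrialStep h c (R.x k) (R.μ k) (R.step k) :=
  R.trial k _ le_rfl

/-- The accepted parameters are bounded if eventually all trials with a large parameter are
accepted. -/
theorem bddAbove_range_μ_of_eventually_accepts {C : ℝ}
    (hC : ∀ᶠ k in atTop, ∀ j ≤ R.J k, C ≤ R.τ ^ j * R.ν k →
      Accepts h c R.σ (R.x k) (R.d k j) (R.xp k j)) : BddAbove (range R.μ) := by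
  obtain ⟨k₀, hk₀⟩ := eventually_atTop.1 hC
  have hτ : 0 < R.τ := zero_lt_one.trans R.one_lt_τ
  -- Either the first trial is accepted, or the last rejected one had parameter below `C` and was
  -- raised once by `τ`.
  have hμ : ∀ k ≥ k₀, R.μ k ≤ max (R.ν k) (R.τ * C) := fun k hk => by
    rcases hJ : R.J k with _ | j
    · simp [μ, hJ]
    · refine le_max_of_le_right ?_
      have hlt : R.τ ^ j * R.ν k < C := by
        by_contra! hle
        exact R.rejected k j (by omega) (hk₀ k hk j (by omega) hle)
      rw [μ, hJ, pow_succ', mul_assoc]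
      gcongr
  set B := max R.μmin (max (R.ν k₀) (R.τ * C)) with hB
  have hν : ∀ k ≥ k₀, R.ν k ≤ B := fun k hk => by
    induction k, hk using Nat.le_induction with
    | base => exact le_max_of_le_right (le_max_left _ _)
    | succ k hk ih =>
      rw [R.ν_succ]
      refine max_le (le_max_left _ _) ?_
      calc R.μ k / R.τ ≤ R.μ k := div_le_self (R.μ_pos k).le R.one_lt_τ.le
        _ ≤ max (R.ν k) (R.τ * C) := hμ k hk
        _ ≤ B := max_le ih (le_max_of_le_right (le_max_right _ _))
  exact IsBoundedUnder.bddAbove_range ⟨B, eventually_map.2 (eventually_atTop.2 ⟨k₀, fun k hk =>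
    (hμ k hk).trans (max_le (hν k hk) (le_max_of_le_right (le_max_right _ _)))⟩)⟩

/-- Along a convergent run with efficient projections the accepted parameters are bounded. -/
theorem bddAbove_range_μ (hh : ConvexOn ℝ univ h) (hcont : Continuous h) {xbar : E}
    (hc : ContinuousAt c xbar) (hc' : ContinuousAt (fderiv ℝ c) xbar) {v : F}
    (hv : v ∈ subdiff h (c xbar)) (heff : R.UsesEfficientProjectionNear xbar)
    (hlim : Tendsto R.x atTop (𝓝 xbar)) : BddAbove (range R.μ) := by
  obtain ⟨γ, hγ, δ, hδ, hproj⟩ := heff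
  have hpred : ∀ᶠ q : E × E in 𝓝 xbar ×ˢ 𝓝 0,
      |h (linearization c q.1 q.2) - h (c xbar)| < δ := by
    have : Tendsto (fun q : E × E => |h (linearization c q.1 q.2) - h (c xbar)|)
        (𝓝 xbar ×ˢ 𝓝 0) (𝓝 |h (c xbar) - h (c xbar)|) :=
      (((hcont.tendsto _).comp (tendsto_linearization hc hc')).sub_const _).abs
    rw [sub_self, abs_zero] at this
    exact this.eventually_lt_const hδ
  obtain ⟨p, hp, q, hq, hpq⟩ := eventually_prod_iff.1 hpred
  obtain ⟨s, hs, hsq⟩ := Metric.eventually_nhds_iff_ball.1 hq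
  -- `s/2` stays inside the open ball, `δ` meets the step condition of efficient projection, and
  -- `1/(2γ)` gives the half-step test.
  set s' := min (s / 2) (min δ (1 / (2 * γ))) with hs'
  have hs'0 : 0 < s' := by positivity
  obtain ⟨C, hC⟩ := exists_forall_trialStep_norm_le hh hcont hc hc' hv hs'0
  refine R.bddAbove_range_μ_of_eventually_accepts (C := max C (2 * γ / (1 - R.σ))) ?_
  filter_upwards [hlim.eventually hp, hlim.eventually hC,
    hlim.eventually (Metric.closedBall_mem_nhds xbar hδ)] with k hk1 hk2 hk3 j hj hjC
  have hd := R.trial k j hj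
  have hds := hk2 _ ((le_max_left _ _).trans hjC) _ hd
  have hd1 : ‖R.d k j‖ ≤ s / 2 := hds.trans (min_le_left _ _)
  have hd2 : ‖R.d k j‖ ≤ δ := hds.trans ((min_le_right _ _).trans (min_le_left _ _))
  have hd3 : ‖R.d k j‖ ≤ 1 / (2 * γ) := hds.trans ((min_le_right _ _).trans (min_le_right _ _))
  refine (hproj k j hj (by rwa [← dist_eq_norm]) hd2 (hpq hk1 (hsq _ ?_))).elim
    (fun he => he.accepts hd R.σ_lt_one ((le_max_right _ _).trans hjC) ?_) id
  · rw [mem_ball_zero_iff]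
    linarith
  · calc γ * ‖R.d k j‖ ≤ γ * (1 / (2 * γ)) := by gcongr
      _ = 1 / 2 := by field_simp

/-- The accepted steps of a convergent run tend to zero. -/
theorem tendsto_step {xbar : E} (hlim : Tendsto R.x atTop (𝓝 xbar)) :
    Tendsto R.step atTop (𝓝 0) := by
  -- The half-step test and the triangle inequality give `‖d k‖ ≤ 2‖x (k+1) - x k‖`.
  have h1 : Tendsto (fun k => 2 * ‖R.x (k + 1) - R.x k‖) atTop (𝓝 0) := by
    simpa using (((hlim.comp (tendsto_add_atTop_nat 1)).sub hlim).norm.const_mul 2)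
  refine squeeze_zero_norm (fun k => ?_) h1
  have h2 := (R.accepted k).2
  rw [← R.x_succ] at h2
  have h3 : ‖R.step k‖ ≤ ‖R.x (k + 1) - R.x k‖ + ‖R.x (k + 1) - (R.x k + R.step k)‖ := by
    rw [show R.step k = (R.x (k + 1) - R.x k) - (R.x (k + 1) - (R.x k + R.step k)) by abel]
    simpa using norm_sub_le (R.x (k + 1) - R.x k) (R.x (k + 1) - (R.x k + R.step k))
  change ‖R.x (k + 1) - (R.x k + R.step k)‖ ≤ 1 / 2 * ‖R.step k‖ at h2
  linarith

end ProxDescentRun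

end Descent

/-! ### Convergence of multipliers. -/

section Multipliers

variable {E F : Type*} [NormedAddCommGroup E] [InnerProductSpace ℝ E] [CompleteSpace E]
  [NormedAddCommGroup F] [InnerProductSpace ℝ F] [FiniteDimensional ℝ F]

/-- Under the constraint qualification, asymptotic multipliers converge to the unique multiplier. -/
theorem tendsto_multiplier {h : F → ℝ} (hh : ConvexOn ℝ univ h) (hcont : Continuous h) {c : E → F}
    {xbar : E} (hc' : ContinuousAt (fderiv ℝ c) xbar) (hcq : ConstraintQualification h c xbar)
    {w : F} (hw : w ∈ subdiff h (c xbar)) (hwnull : w ∈ nullAdjoint c xbar)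
    {ι : Type*} {l : Filter ι} {x : ι → E} {z v : ι → F} (hx : Tendsto x l (𝓝 xbar))
    (hz : Tendsto z l (𝓝 (c xbar))) (hmem : ∀ i, v i ∈ subdiff h (z i))
    (hv : Tendsto (fun i => ContinuousLinearMap.adjoint (fderiv ℝ c (x i)) (v i)) l (𝓝 0)) :
    Tendsto v l (𝓝 w) := by
  -- By local boundedness `v` converges along each ultrafilter, so it suffices that every such limit
  -- is `w`.
  rw [tendsto_iff_ultrafilter]
  intro U hU
  obtain ⟨L, hL⟩ := eventually_subdiff_subset_closedBall hh hcont (c xbar)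
  have hbdd : ∀ᶠ i in (U : Filter ι), v i ∈ Metric.closedBall 0 L :=
    ((hz.mono_left hU).eventually hL).mono fun i hi => hi (hmem i)
  obtain ⟨u, -, hu⟩ := (isCompact_closedBall (0 : F) L).ultrafilter_le_nhds (U.map v)
    (by rw [le_principal_iff]; exact hbdd)
  have hvu : Tendsto v U (𝓝 u) := hu
  have hu1 : u ∈ subdiff h (c xbar) :=
    mem_subdiff_of_tendsto hh hcont (hz.mono_left hU) hvu hmem
  have hadj : Tendsto (fun i => ContinuousLinearMap.adjoint (fderiv ℝ c (x i))) l
      (𝓝 (ContinuousLinearMap.adjoint (fderiv ℝ c xbar))) :=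
    ((ContinuousLinearMap.adjoint (𝕜 := ℝ) (E := E) (F := F)).continuous.tendsto _).comp
      (hc'.tendsto.comp hx)
  have hu2 : ContinuousLinearMap.adjoint (fderiv ℝ c xbar) u = 0 :=
    tendsto_nhds_unique ((isBoundedBilinearMap_apply (𝕜 := ℝ)).continuous.tendsto
      (ContinuousLinearMap.adjoint (fderiv ℝ c xbar), u) |>.comp
        ((hadj.mono_left hU).prodMk_nhds hvu)) (hv.mono_left hU)
  -- Two multipliers differ by an element of the subspace that the constraint qualification makes
  -- trivial.
  have huw : u - w ∈ (affineSpan ℝ (subdiff h (c xbar))).direction ⊓ nullAdjoint c xbar :=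
    ⟨AffineSubspace.vsub_mem_direction (subset_affineSpan ℝ _ hu1) (subset_affineSpan ℝ _ hw),
      Submodule.sub_mem _ (LinearMap.mem_ker.2 hu2) hwnull⟩
  rw [hcq, Submodule.mem_bot, sub_eq_zero] at huw
  exact huw ▸ hvu

end Multipliers

end ProxLin

theorem mainTheorem6 {n m : ℕ}
    (h : EuclideanSpace ℝ (Fin m) → ℝ)
    (c : EuclideanSpace ℝ (Fin n) → EuclideanSpace ℝ (Fin m))
    (xbar : EuclideanSpace ℝ (Fin n))
    (M : Set (EuclideanSpace ℝ (Fin m)))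
    (hcrit : ProxLin.IsCritical (h ∘ c) xbar)
    (hc : ContDiffAt ℝ 2 c xbar)
    (hconv : ConvexOn ℝ Set.univ h)
    (hps : ProxLin.PartlySmoothAt h M (c xbar))
    (hcq : ProxLin.ConstraintQualification h c xbar)
    (hri : ProxLin.StrictlyCritical h c xbar)
    (R : ProxLin.ProxDescentRun h c)
    (heff : R.UsesEfficientProjectionNear xbar)
    (hlim : Filter.Tendsto R.x Filter.atTop (nhds xbar)) :
    (∀ᶠ r in Filter.atTop, c (R.x r) + fderiv ℝ c (R.x r) (R.step r) ∈ M) ∧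
      BddAbove (Set.range R.μ) := by
  have hcont : Continuous h := hconv.locallyLipschitz.continuous
  have hc0 : ContinuousAt c xbar := hc.continuousAt
  have hc1 : ContinuousAt (fderiv ℝ c) xbar :=
    (hc.fderiv_right (m := 1) (by norm_num)).continuousAt
  obtain ⟨w, hwri, hwnull⟩ := hri
  have hw : w ∈ ProxLin.subdiff h (c xbar) := intrinsicInterior_subset hwri
  have hbdd : BddAbove (range R.μ) := R.bddAbove_range_μ hconv hcont hc0 hc1 hw heff hlim
  refine ⟨?_, hbdd⟩
  have hstep := R.tendsto_step hlim
  have hz : Tendsto (fun r => ProxLin.linearization c (R.x r) (R.step r)) atTop (𝓝 (c xbar)) :=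
    (ProxLin.tendsto_linearization hc0 hc1).comp (hlim.prodMk hstep)
  choose v hv hvadj using fun r =>
    ProxLin.exists_mem_subdiff_of_isLocalMin_proxObjective hconv hcont (R.isTrialStep r).1
  -- Vanishing steps alone do not suffice here: boundedness of `μ` is what sends the residual of the
  -- multiplier equation to zero.
  have hμd : Tendsto (fun r => -(R.μ r • R.step r)) atTop (𝓝 0) := by
    obtain ⟨B, hB⟩ := hbdd
    have h0 : Tendsto (fun r => B * ‖R.step r‖) atTop (𝓝 0) := by
      simpa using hstep.norm.const_mul B
    refine squeeze_zero_norm (fun r => ?_) h0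
    rw [norm_neg, norm_smul, Real.norm_of_nonneg (R.μ_pos r).le]
    gcongr
    exact hB ⟨r, rfl⟩
  have hvw := ProxLin.tendsto_multiplier hconv hcont hc1 hcq hw hwnull hlim hz hv
    (hμd.congr fun r => (hvadj r).symm)
  exact hps.eventually_mem hconv hz hvw hv hwri
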